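/- Let $\mathbb R[z]$ be the real polynomial algebra in the variables $z_{(\Xi,k)}$ and $z_{(\Gamma,k)}$, $k\in\mathbb N=\{0,1,2,\dots\}$, with monomials $z^\beta$ indexed by finitely supported multi-indices $\beta$. Put $$((\beta))=\sum_k\beta(\Xi,k),\qquad [\beta]=\sum_k(1-k)\,\beta(\Xi,k)-\sum_k(1+k)\,\beta(\Gamma,k).$$ For $N\ge2$ let $\mathfrak M^N$ be the set of $\beta$ with $[\beta]=1$ and $((\beta))=N$, let $\mathfrak M_\Xi^N$ be the set of those $\beta\in\mathfrak M^N$ with $\beta(\Gamma,k)=0$ for all $k$, let $\mathcal M^N$ be the linear span of $\{z^\beta:\beta\in\mathfrak M^N\}$, and let $\mathcal M=\bigoplus_{N\ge2}\mathcal M^N$. For smooth $\Gamma,\sigma:\mathbb R\to\mathbb R$ let $\Upsilon_{\Gamma,\sigma}$ be the linear map with $$\Upsilon_{\Gamma,\sigma}(z^\beta)(u)=\prod_k\bigl(2\Gamma^{(k)}(u)\bigr)^{\beta(\Gamma,k)}\prod_k\bigl(\sigma^{(k)}(u)\bigr)^{\beta(\Xi,k)}.$$ A smooth diffeomorphism $\varphi$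 of $\mathbb R$ acts on functions $g$ (in particular on $\sigma$ and on $\Upsilon_{\Gamma,\sigma}(v)$) by $(\varphi\cdot g)(\varphi(u))=\varphi'(u)g(u)$, and on $\Gamma$ by $(\varphi\cdot\Gamma)(\varphi(u))\,\varphi'(u)^2=\varphi'(u)\Gamma(u)-\varphi''(u)$. Let $V_{\rm geo}$ be the space of all $v\in\mathcal M$ such that $\varphi\cdot\Upsilon_{\Gamma,\sigma}(v)=\Upsilon_{\varphi\cdot\Gamma,\varphi\cdot\sigma}(v)$ for all smooth $\Gamma,\sigma$ and all diffeomorphisms $\varphi$ of $\mathbb R$ that are homotopic to the identity through diffeomorphisms, and let $V_{\rm geo}^N=V_{\rm geo}\cap\mathcal M^N$. Let $D$ be the derivation of $\mathbb R[z]$ with $Dz_{(\Xi,k)}=z_{(\Xi,k+1)}$ and $Dz_{(\Gamma,k)}=z_{(\Gamma,k+1)}$, and let $\nabla_{v_1}v_2=v_1Dv_2+\tfrac12z_{(\Gamma,0)}v_1v_2$. Let $\mathfrak B_1=\{z_{(\Xi,0)}\}$ and, for $N\ge2$, $\mathfrak B_N=\{\nabla_{v_1}v_2: v_1\in\mathfrak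 B_i,\ v_2\in\mathfrak B_j,\ i,j\ge1,\ i+j=N\}$, the set of the elements obtained by iterating the covariant derivative $N-1$ times on $z_{(\Xi,0)}$. **Theorem.** For every $N\ge2$ the linear span of $\mathfrak B_N$ is $V_{\rm geo}^N$, the set $\mathfrak M_\Xi^N$ is finite, and $\dim V_{\rm geo}^N=\mathrm{Card}(\mathfrak M_\Xi^N)$. Moreover, let $N_\xi\in\mathbb N$ be arbitrary; in particular it may be the index attached to an admissible, spatially symmetric noise $\xi$, up to which the numbers of noises of the multi-indices of negative homogeneity are considered. Then the set $\mathfrak B_\xi=\bigcup_{i=2}^{N_\xi}\mathfrak B_i$ generates $V_{\rm geo}^\xi=\bigoplus_{i=2}^{N_\xi}V_{\rm geo}^i$, the set $\mathfrak B_\xi^{\rm even}=\bigcup_{i=1}^{\lfloor N_\xi/2\rfloor}\mathfrak B_{2i}$ generates $V_{\rm geo}^{\xi,\rm even}=\bigoplus_{i=1}^{\lfloor N_\xi/2\rfloor}V_{\rm geo}^{2i}$, and $$\dim V_{\rm geo}^\xi=\sum_{i=2}^{N_\xi}\mathrm{Card}(\mathfrak M_\Xi^i),\qquad \dim V_{\rm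 geo}^{\xi,\rm even}=\sum_{i=1}^{\lfloor N_\xi/2\rfloor}\mathrm{Card}(\mathfrak M_\Xi^{2i}).$$ -/

import Mathlib

open scoped ContDiff Manifold

namespace GKPZ

/-- The variables of the reduced multi-indices: `noise k` is the variable attached to `σ⁽ᵏ⁾`
(written `z_(Ξ,k)`), and `quad k` is the variable attached to `2 Γ⁽ᵏ⁾`, the `k`-th derivative of
the coefficient of `(∂ₓ u)²`. -/
inductive Var : Type
  | noise (k : ℕ) : Var
  | quad (k : ℕ) : Var

/-- The length of the standard multi-index carried by a variable: `k e_(0,0)` for `noise k` and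
`k e_(0,0) + 2 e_(0,1)` for `quad k`. -/
def Var.length : Var → ℕ
  | .noise k => k
  | .quad k => k + 2

/-- The number of noises carried by a variable. -/
def Var.noiseCount : Var → ℕ
  | .noise _ => 1
  | .quad _ => 0

/-- The variable with one more derivative. -/
def Var.succ : Var → Var
  | .noise k => .noise (k + 1)
  | .quad k => .quad (k + 1)

/-- Finitely supported multi-indices over the variables. -/
abbrev MultiIndex : Type := Var →₀ ℕ

/-- The polynomial algebra in the variables; `MvPolynomial.monomial β 1` is `z^β`. -/
abbrev Poly : Type := MvPolynomial Var ℝ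

/-- The noise factor `((β))`. -/
def noiseFactor (β : MultiIndex) : ℕ := β.sum fun v m => m * v.noiseCount

/-- The fertility factor `[β] = ∑ (1 - ℓ(k)) β(k)`. -/
def fertility (β : MultiIndex) : ℤ := β.sum fun v m => (1 - (v.length : ℤ)) * (m : ℤ)

/-- The reduced multi-indices: `[β] = 1` and `((β)) ≥ 2`. -/
def reduced : Set MultiIndex := {β | fertility β = 1 ∧ 2 ≤ noiseFactor β}

/-- The reduced multi-indices with exactly `N` noises. -/
def reducedN (N : ℕ) : Set MultiIndex := {β | β ∈ reduced ∧ noiseFactor β = N}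

/-- The reduced multi-indices with exactly `N` noises which involve the noise variables only
(the index set of the monomials spanning the degree `N` part of the free Novikov algebra). -/
def noiseOnlyN (N : ℕ) : Set MultiIndex := {β | β ∈ reducedN N ∧ ∀ k, β (.quad k) = 0}

/-- The linear space generated by the monomials `z^β` with `β ∈ S`. -/
noncomputable def monomialSpan (S : Set MultiIndex) : Submodule ℝ Poly :=
  Submodule.span ℝ ((fun β => MvPolynomial.monomial β (1 : ℝ)) '' S)

/-- The derivation `D` with `D z_(·,k) = z_(·,k+1)`. -/
noncomputable def D : Derivation ℝ Poly Poly :=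
  MvPolynomial.mkDerivation ℝ fun v => MvPolynomial.X v.succ

/-- The covariant derivative `∇_{v₁} v₂ = v₁ D v₂ + (1/2) z_(quad,0) v₁ v₂`. -/
noncomputable def covDeriv (v₁ v₂ : Poly) : Poly :=
  v₁ * D v₂ + (1 / 2 : ℝ) • (MvPolynomial.X (.quad 0) * v₁ * v₂)

/-- `IsIterated N v`: `v` is a bracketing, by the covariant derivative, of `N` copies of
`z_(Ξ,0)`, that is, it is obtained from `z_(Ξ,0)` by `N - 1` applications of `∇`. -/
inductive IsIterated : ℕ → Poly → Prop
  | base : IsIterated 1 (MvPolynomial.X (.noise 0))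
  | step {i j : ℕ} {v₁ v₂ : Poly} (h₁ : IsIterated i v₁) (h₂ : IsIterated j v₂) :
      IsIterated (i + j) (covDeriv v₁ v₂)

/-- The set of the iterated covariant derivatives of `z_(Ξ,0)` with `N` noises. -/
def B (N : ℕ) : Set Poly := {v | IsIterated N v}

/-- The value at `u` of the function attached to a variable. -/
noncomputable def varValue (Γ σ : ℝ → ℝ) (u : ℝ) : Var → ℝ
  | .noise k => iteratedDeriv k σ u
  | .quad k => 2 * iteratedDeriv k Γ u

/-- The evaluation map `Υ_{Γ,σ}`: linear in `v`, with
`Υ(z^β)(u) = ∏ (2 Γ⁽ᵏ⁾(u))^β(quad,k) ∏ (σ⁽ᵏ⁾(u))^β(Ξ,k)`. -/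
noncomputable def Upsilon (Γ σ : ℝ → ℝ) (v : Poly) (u : ℝ) : ℝ :=
  MvPolynomial.eval (varValue Γ σ u) v

/-- Smooth diffeomorphisms of the real line. -/
abbrev LineDiffeo : Type := Diffeomorph 𝓘(ℝ, ℝ) 𝓘(ℝ, ℝ) ℝ ℝ ∞

/-- `φ` is homotopic to the identity through diffeomorphisms. -/
def HomotopicToId (φ : LineDiffeo) : Prop :=
  ∃ H : unitInterval → LineDiffeo,
    Continuous (fun p : unitInterval × ℝ => H p.1 p.2) ∧
      (∀ u, H 0 u = u) ∧ (∀ u, H 1 u = φ u)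

/-- The action on vector fields: `(φ · g)(φ(u)) = φ'(u) g(u)`. -/
noncomputable def actVec (φ : LineDiffeo) (g : ℝ → ℝ) (y : ℝ) : ℝ :=
  deriv φ (φ.symm y) * g (φ.symm y)

/-- The action on connections: `(φ · Γ)(φ(u)) φ'(u)² = φ'(u) Γ(u) - φ''(u)`. -/
noncomputable def actConn (φ : LineDiffeo) (Γ : ℝ → ℝ) (y : ℝ) : ℝ :=
  (deriv φ (φ.symm y) * Γ (φ.symm y) - deriv (deriv φ) (φ.symm y)) / deriv φ (φ.symm y) ^ 2

/-- The space of geometric elements: the linear combinations `v` of reduced monomials such that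
`φ · Υ_{Γ,σ}(v) = Υ_{φ·Γ, φ·σ}(v)` for all smooth `Γ`, `σ` and all diffeomorphisms `φ` homotopic
to the identity. -/
noncomputable def VGeo : Submodule ℝ Poly where
  carrier := {v | v ∈ monomialSpan reduced ∧
    ∀ Γ σ : ℝ → ℝ, ContDiff ℝ ∞ Γ → ContDiff ℝ ∞ σ →
      ∀ φ : LineDiffeo, HomotopicToId φ →
        actVec φ (Upsilon Γ σ v) = Upsilon (actConn φ Γ) (actVec φ σ) v}
  add_mem' := by
    rintro v w ⟨hv, hv'⟩ ⟨hw, hw'⟩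
    refine ⟨Submodule.add_mem _ hv hw, fun Γ σ hΓ hσ φ hφ => ?_⟩
    funext y
    have h1 := congrFun (hv' Γ σ hΓ hσ φ hφ) y
    have h2 := congrFun (hw' Γ σ hΓ hσ φ hφ) y
    simp only [actVec, Upsilon, map_add] at h1 h2 ⊢
    rw [← h1, ← h2, mul_add]
  zero_mem' := by
    refine ⟨Submodule.zero_mem _, fun Γ σ _ _ φ _ => ?_⟩
    funext y
    simp [actVec, Upsilon]
  smul_mem' := by
    rintro c v ⟨hv, hv'⟩
    refine ⟨Submodule.smul_mem _ c hv, fun Γ σ hΓ hσ φ hφ => ?_⟩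
    funext y
    have h1 := congrFun (hv' Γ σ hΓ hσ φ hφ) y
    simp only [actVec, Upsilon, MvPolynomial.smul_eval] at h1 ⊢
    rw [← h1]
    ring

/-- The geometric elements with exactly `N` noises. -/
noncomputable def VGeoN (N : ℕ) : Submodule ℝ Poly := VGeo ⊓ monomialSpan (reducedN N)

/-- The generators with at most `n` noises (`n` is the index determined by the noise `ξ`). -/
def BXi (n : ℕ) : Set Poly := ⋃ i ∈ Finset.Icc 2 n, B i

/-- The generators with an even number, at most `n`, of noises. -/
def BXiEven (n : ℕ) : Set Poly := ⋃ i ∈ Finset.Icc 1 (n / 2), B (2 * i)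

/-- The sum, for `2 ≤ i ≤ n`, of the spaces `VGeoN i`; it is direct, because distinct `VGeoN i` are
spanned by combinations of disjoint sets of monomials. -/
noncomputable def VGeoXi (n : ℕ) : Submodule ℝ Poly := ⨆ i ∈ Finset.Icc 2 n, VGeoN i

/-- The sum, for `1 ≤ i ≤ n / 2`, of the spaces `VGeoN (2 * i)`; it is direct as well. -/
noncomputable def VGeoXiEven (n : ℕ) : Submodule ℝ Poly :=
  ⨆ i ∈ Finset.Icc 1 (n / 2), VGeoN (2 * i)

end GKPZ

/-!
Iterated covariant derivatives are geometric because `Υ` turns `D` into differentiation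
(`hasDerivAt_Upsilon`), and the terms in `φ''` coming from the derivative and from the connection
cancel (`IsGeometric.covDeriv`). The rest of the argument compares `VGeoN N` and the span of `B N`
with the degree `N` part of the free Novikov algebra, through the projection `noiseProj` that sets
the variables `quad k` to zero.

* `noiseProj` is injective on geometric elements (`IsGeometric.eq_zero_of_noiseProj_eq_zero`).
  A compactly supported `Γ` is transformed into the zero connection by the diffeomorphism with
  `φ'' = φ' Γ` (`exists_actConn_eq_zero`). If `noiseProj v = 0`, then `Υ_{0,σ}(v) = 0` for all `σ`,
  so equivariance gives `Υ_{Γ,σ}(v) = 0` for all such `Γ` and all `σ`. Since the finite jets of `Γ`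
  and `σ` at a point are arbitrary (`exists_jet`), the polynomial `v` vanishes.

* `noiseProj` maps the span of `B N` onto the span of the monomials indexed by `noiseOnlyN N`
  (`monomialSpan_noiseOnlyN_le`). Under it the covariant derivative becomes the Novikov product
  `a * D b`, so the point is that every noise monomial of fertility one is a combination of iterated
  Novikov products of `z_(Ξ,0)`. Let `A` be the span of these products. By the Leibniz rule,
  `a₁ ⋯ aₖ * D^k b` lies in `A` for all `aᵢ, b ∈ A` (`mul_iterate_derivation_mem`); taking
  `b = z_(Ξ,0)`, an induction on the degree shows that a noise monomial of fertility `k ≥ 1` lies in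
  the power `A ^ k` (`monomial_mem_pow`).

As the span of `B N` is contained in `VGeoN N`, both are mapped bijectively onto the span of the
monomials of `noiseOnlyN N`. The statements on sums over several `N` follow because the spaces
`VGeoN N` involve disjoint sets of monomials (`supIndep_VGeoN`).
-/

namespace GKPZ
open MvPolynomial

/-! ### Equivariance of the covariant derivative -/

lemma D_X (v : Var) : D (X v) = X v.succ := mkDerivation_X _ _ _

/-- The equivariance that defines geometric elements, for a polynomial with arbitrary monomials. -/
def IsGeometric (v : Poly) : Prop :=
  ∀ Γ σ : ℝ → ℝ, ContDiff ℝ ∞ Γ → ContDiff ℝ ∞ σ →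
    ∀ φ : LineDiffeo, HomotopicToId φ →
      actVec φ (Upsilon Γ σ v) = Upsilon (actConn φ Γ) (actVec φ σ) v

lemma hasDerivAt_iteratedDeriv {f : ℝ → ℝ} (hf : ContDiff ℝ ∞ f) (k : ℕ) (u : ℝ) :
    HasDerivAt (iteratedDeriv k f) (iteratedDeriv (k + 1) f u) u := by
  rw [iteratedDeriv_succ]
  exact ((hf.differentiable_iteratedDeriv k (by exact_mod_cast WithTop.coe_lt_top _)) u).hasDerivAt

lemma hasDerivAt_Upsilon {Γ σ : ℝ → ℝ} (hΓ : ContDiff ℝ ∞ Γ) (hσ : ContDiff ℝ ∞ σ) (v : Poly)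
    (u : ℝ) : HasDerivAt (Upsilon Γ σ v) (Upsilon Γ σ (D v) u) u := by
  induction v using MvPolynomial.induction_on with
  | C a =>
    have h : Upsilon Γ σ (C a) = fun _ => a := funext fun u => by simp [Upsilon]
    rw [h, show D (C a) = 0 from derivation_C _ a]
    simpa [Upsilon] using hasDerivAt_const u a
  | add p q hp hq =>
    have h : Upsilon Γ σ (p + q) = Upsilon Γ σ p + Upsilon Γ σ q :=
      funext fun u => by simp [Upsilon]
    rw [h]
    simpa [Upsilon] using hp.add hq
  | mul_X p w hp =>
    have hw : HasDerivAt (fun u => varValue Γ σ u w) (varValue Γ σ u w.succ) u := by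
      cases w with
      | noise k => exact hasDerivAt_iteratedDeriv hσ k u
      | quad k => exact (hasDerivAt_iteratedDeriv hΓ k u).const_mul 2
    have h : Upsilon Γ σ (p * X w) = Upsilon Γ σ p * fun u => varValue Γ σ u w :=
      funext fun u => by simp [Upsilon]
    rw [h]
    convert! hp.mul hw using 1
    simp only [Upsilon, Derivation.leibniz, D_X, smul_eq_mul, map_add, map_mul, eval_X]
    ring

lemma Upsilon_covDeriv (Γ σ : ℝ → ℝ) (v w : Poly) (u : ℝ) :
    Upsilon Γ σ (covDeriv v w) u =
      Upsilon Γ σ v u * Upsilon Γ σ (D w) u + Γ u * Upsilon Γ σ v u * Upsilon Γ σ w u := by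
  simp only [covDeriv, Upsilon, map_add, map_mul, smul_eval, eval_X, varValue, iteratedDeriv_zero]
  ring

lemma LineDiffeo.contDiff (φ : LineDiffeo) : ContDiff ℝ ∞ φ := φ.contMDiff.contDiff

lemma LineDiffeo.contDiff_symm (φ : LineDiffeo) : ContDiff ℝ ∞ φ.symm :=
  φ.symm.contMDiff.contDiff

lemma contDiff_deriv {f : ℝ → ℝ} (hf : ContDiff ℝ ∞ f) : ContDiff ℝ ∞ (deriv f) :=
  (contDiff_infty_iff_deriv.1 hf).2

lemma hasDerivAt_of_contDiff {f : ℝ → ℝ} (hf : ContDiff ℝ ∞ f) (u : ℝ) :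
    HasDerivAt f (deriv f u) u := (hf.differentiable (by simp) u).hasDerivAt

lemma LineDiffeo.deriv_ne_zero (φ : LineDiffeo) (u : ℝ) : deriv φ u ≠ 0 := by
  have h := (hasDerivAt_of_contDiff φ.contDiff_symm (φ u)).comp u
    (hasDerivAt_of_contDiff φ.contDiff u)
  have h2 : (φ.symm ∘ φ) = id := by ext x; simp
  rw [h2] at h
  have := h.unique (hasDerivAt_id u)
  intro h0
  simp [h0] at this

lemma contDiff_actVec (φ : LineDiffeo) {g : ℝ → ℝ} (hg : ContDiff ℝ ∞ g) :
    ContDiff ℝ ∞ (actVec φ g) :=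
  ((contDiff_deriv φ.contDiff).mul hg).comp φ.contDiff_symm

lemma contDiff_actConn (φ : LineDiffeo) {Γ : ℝ → ℝ} (hΓ : ContDiff ℝ ∞ Γ) :
    ContDiff ℝ ∞ (actConn φ Γ) := by
  have h1 := contDiff_deriv φ.contDiff
  exact (((h1.mul hΓ).sub (contDiff_deriv h1)).div (h1.pow 2)
    fun u => pow_ne_zero 2 (φ.deriv_ne_zero u)).comp φ.contDiff_symm

/-- The terms `φ'' v₁ v₂` produced by the derivative and by the connection cancel. -/
lemma IsGeometric.covDeriv {v w : Poly} (hv : IsGeometric v) (hw : IsGeometric w) :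
    IsGeometric (covDeriv v w) := by
  intro Γ σ hΓ hσ φ hφ
  funext y
  obtain ⟨u, rfl⟩ : ∃ u, φ u = y := ⟨φ.symm y, by simp⟩
  have hV := congrFun (hv Γ σ hΓ hσ φ hφ) (φ u)
  have hW := congrFun (hw Γ σ hΓ hσ φ hφ) (φ u)
  have hd : HasDerivAt (fun x => deriv φ x * Upsilon Γ σ w x)
      (deriv (deriv φ) u * Upsilon Γ σ w u + deriv φ u * Upsilon Γ σ (D w) u) u :=
    (hasDerivAt_of_contDiff (contDiff_deriv φ.contDiff) u).mul (hasDerivAt_Upsilon hΓ hσ w u)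
  have hd' := (hasDerivAt_Upsilon (contDiff_actConn φ hΓ) (contDiff_actVec φ hσ) w (φ u)).comp u
    (hasDerivAt_of_contDiff φ.contDiff u)
  have he : Upsilon (actConn φ Γ) (actVec φ σ) w ∘ φ = fun x => deriv φ x * Upsilon Γ σ w x := by
    rw [← hw Γ σ hΓ hσ φ hφ]
    ext x
    simp [actVec]
  rw [he] at hd'
  have hu := hd'.unique hd
  have hne := φ.deriv_ne_zero u
  rw [Upsilon_covDeriv, ← hV, ← hW, eq_div_of_mul_eq hne hu]
  simp only [actVec, actConn, Diffeomorph.symm_apply_apply, Upsilon_covDeriv]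
  field_simp
  ring

lemma isGeometric_X_noise_zero : IsGeometric (X (.noise 0)) := by
  intro Γ σ _ _ φ _
  funext y
  simp [Upsilon, varValue, actVec]

lemma IsIterated.isGeometric {N : ℕ} {v : Poly} (h : IsIterated N v) : IsGeometric v := by
  induction h with
  | base => exact isGeometric_X_noise_zero
  | step _ _ h₁ h₂ => exact h₁.covDeriv h₂

lemma IsGeometric.add {v w : Poly} (hv : IsGeometric v) (hw : IsGeometric w) :
    IsGeometric (v + w) := by
  intro Γ σ hΓ hσ φ hφ
  funext y
  have h1 := congrFun (hv Γ σ hΓ hσ φ hφ) y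
  have h2 := congrFun (hw Γ σ hΓ hσ φ hφ) y
  simp only [actVec, Upsilon, map_add] at h1 h2 ⊢
  rw [← h1, ← h2, mul_add]

lemma IsGeometric.smul {v : Poly} (hv : IsGeometric v) (c : ℝ) : IsGeometric (c • v) := by
  intro Γ σ hΓ hσ φ hφ
  funext y
  have h1 := congrFun (hv Γ σ hΓ hσ φ hφ) y
  simp only [actVec, Upsilon, MvPolynomial.smul_eval] at h1 ⊢
  rw [← h1]
  ring

/-! ### Diffeomorphisms flattening a connection -/

lemma exists_lineDiffeo {f : ℝ → ℝ} (hf : ContDiff ℝ ∞ f) {c : ℝ} (hc : 0 < c)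
    (hd : ∀ u, c ≤ deriv f u) : ∃ φ : LineDiffeo, ⇑φ = f := by
  have hmono : StrictMono f := strictMono_of_deriv_pos fun u => hc.trans_le (hd u)
  have hm : Monotone fun u => f u - c * u := by
    refine monotone_of_deriv_nonneg
      ((hf.differentiable (by simp)).sub (differentiable_id.const_mul c)) fun u => ?_
    have := (hasDerivAt_of_contDiff hf u).sub ((hasDerivAt_id u).const_mul c)
    simp only [mul_one, id] at this
    rw [show deriv (fun u => f u - c * u) u = _ from this.deriv]
    linarith [hd u]
  have htop : Filter.Tendsto f Filter.atTop Filter.atTop := by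
    refine Filter.tendsto_atTop_mono' _ ?_
      (Filter.tendsto_atTop_add_const_left _ (f 0) (Filter.tendsto_id.const_mul_atTop hc))
    filter_upwards [Filter.eventually_ge_atTop 0] with u hu
    have := hm hu
    simp only [mul_zero, id] at this ⊢
    linarith
  have hbot : Filter.Tendsto f Filter.atBot Filter.atBot := by
    refine Filter.tendsto_atBot_mono' _ ?_
      (Filter.tendsto_atBot_add_const_left _ (f 0) (Filter.tendsto_id.const_mul_atBot hc))
    filter_upwards [Filter.eventually_le_atBot 0] with u hu
    have := hm hu
    simp only [mul_zero, id] at this ⊢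
    linarith
  have hsurj := hf.continuous.surjective htop hbot
  let e : ℝ ≃ₜ ℝ := (hmono.orderIsoOfSurjective f hsurj).toHomeomorph
  have he : ⇑e = f := rfl
  have hsymm : ContDiff ℝ ∞ e.symm :=
    e.contDiff_symm_deriv (f' := deriv f) (fun u => (hc.trans_le (hd u)).ne')
      (fun u => hasDerivAt_of_contDiff hf u) hf
  exact ⟨{ toEquiv := e.toEquiv
           contMDiff_toFun := hf.contMDiff
           contMDiff_invFun := hsymm.contMDiff }, rfl⟩

/-- The homotopy to the identity is the segment between the two maps. -/
lemma exists_lineDiffeo_homotopicToId {f : ℝ → ℝ} (hf : ContDiff ℝ ∞ f) {c : ℝ} (hc : 0 < c)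
    (hd : ∀ u, c ≤ deriv f u) : ∃ φ : LineDiffeo, ⇑φ = f ∧ HomotopicToId φ := by
  obtain ⟨φ, hφ⟩ := exists_lineDiffeo hf hc hd
  have hH : ∀ t : unitInterval, ∃ ψ : LineDiffeo, ⇑ψ = fun u => (1 - (t : ℝ)) * u + t * f u := by
    intro t
    refine exists_lineDiffeo ((contDiff_const.mul contDiff_id).add (contDiff_const.mul hf))
      (lt_min one_pos hc) fun u => ?_
    have := ((hasDerivAt_id u).const_mul (1 - (t : ℝ))).add
      ((hasDerivAt_of_contDiff hf u).const_mul (t : ℝ))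
    rw [show deriv (fun u => (1 - (t : ℝ)) * u + t * f u) u = _ from this.deriv]
    have h1 := min_le_left 1 c
    have h2 := (min_le_right 1 c).trans (hd u)
    nlinarith [t.2.1, t.2.2]
  choose H hH using hH
  refine ⟨φ, hφ, H, ?_, ?_, ?_⟩
  · simp only [hH]
    have := hf.continuous
    fun_prop
  · intro u; simp [hH]
  · intro u; simp [hH, hφ]

/-- A compactly supported connection is flattened by a diffeomorphism: `φ' = exp ∫ Γ` solves
`φ'' = φ' Γ`, and it is bounded below because the primitive of `Γ` is bounded. -/
lemma exists_actConn_eq_zero {Γ : ℝ → ℝ} (hΓ : ContDiff ℝ ∞ Γ) (hc : HasCompactSupport Γ) :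
    ∃ φ : LineDiffeo, HomotopicToId φ ∧ actConn φ Γ = 0 := by
  set G : ℝ → ℝ := fun u => ∫ t in (0 : ℝ)..u, Γ t with hG
  have hGd : ∀ u, HasDerivAt G (Γ u) u := fun u =>
    (hΓ.continuous.integral_hasStrictDerivAt 0 u).hasDerivAt
  have hG' : deriv G = Γ := funext fun u => (hGd u).deriv
  have hGs : ContDiff ℝ ∞ G := contDiff_infty_iff_deriv.2
    ⟨fun u => (hGd u).differentiableAt, by rwa [hG']⟩
  have hint : MeasureTheory.Integrable Γ := hΓ.continuous.integrable_of_hasCompactSupport hc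
  have hGb : ∀ u, -(∫ t, ‖Γ t‖) ≤ G u := fun u => by
    have h1 : ‖G u‖ ≤ ∫ t, ‖Γ t‖ :=
      intervalIntegral.norm_integral_le_integral_norm_uIoc.trans
        (MeasureTheory.setIntegral_le_integral hint.norm
          (Filter.Eventually.of_forall fun _ => norm_nonneg _))
    exact neg_le_of_abs_le h1
  have hE : ContDiff ℝ ∞ fun u => Real.exp (G u) := hGs.exp
  set f : ℝ → ℝ := fun u => ∫ t in (0 : ℝ)..u, Real.exp (G t) with hf
  have hfd : deriv f = fun u => Real.exp (G u) := funext fun u =>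
    (hE.continuous.integral_hasStrictDerivAt 0 u).hasDerivAt.deriv
  have hfs : ContDiff ℝ ∞ f := contDiff_infty_iff_deriv.2
    ⟨fun u => (hE.continuous.integral_hasStrictDerivAt 0 u).hasDerivAt.differentiableAt,
      by rwa [hfd]⟩
  obtain ⟨φ, hφ, hφi⟩ := exists_lineDiffeo_homotopicToId hfs (Real.exp_pos (-(∫ t, ‖Γ t‖)))
    fun u => by rw [hfd]; exact Real.exp_le_exp.2 (hGb u)
  refine ⟨φ, hφi, funext fun y => ?_⟩
  have h2 : ∀ u, deriv (deriv φ) u = Real.exp (G u) * Γ u := fun u => by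
    rw [hφ, hfd]; exact (hGd u).exp.deriv
  simp only [actConn, h2]
  simp [hφ, hfd]

/-! ### Geometric elements are determined at the trivial connection -/

/-- Borel's lemma for finite jets: a polynomial with the given Taylor coefficients, cut off by a
bump function. -/
lemma exists_jet (a : ℕ → ℝ) (K : ℕ) : ∃ g : ℝ → ℝ, ContDiff ℝ ∞ g ∧ HasCompactSupport g ∧
    ∀ k < K, iteratedDeriv k g 0 = a k := by
  let χ : ContDiffBump (0 : ℝ) := ⟨1, 2, one_pos, one_lt_two⟩
  let p : Polynomial ℝ := ∑ k ∈ Finset.range K, Polynomial.C (a k / k.factorial) * Polynomial.X ^ k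
  refine ⟨fun u => χ u * p.eval u, ?_, χ.hasCompactSupport.mul_right, fun k hk => ?_⟩
  · exact χ.contDiff.mul (by simpa using p.contDiff_aeval (𝕜 := ℝ) ∞)
  have h1 : (fun u => χ u * p.eval u) =ᶠ[nhds 0] fun u => p.eval u := by
    filter_upwards [χ.eventuallyEq_one] with u hu
    simp [hu]
  rw [h1.iteratedDeriv_eq]
  have h2 : ∀ (n : ℕ) (q : Polynomial ℝ), iteratedDeriv n (fun u => q.eval u) =
      fun u => (Polynomial.derivative^[n] q).eval u := by
    intro n
    induction n with
    | zero => intro q; simp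
    | succ n ih =>
      intro q
      rw [iteratedDeriv_succ', Function.iterate_succ_apply, ← ih]
      congr 1
      funext u
      exact q.deriv
  simp only [h2]
  rw [← Polynomial.coeff_zero_eq_eval_zero, Polynomial.coeff_iterate_derivative]
  have hcoeff : p.coeff k = a k / k.factorial := by
    simp only [p, Polynomial.finsetSum_coeff, Polynomial.coeff_C_mul_X_pow]
    simp [hk]
  have := Nat.factorial_ne_zero k
  simp only [zero_add, Nat.descFactorial_self, hcoeff, nsmul_eq_mul]
  field_simp

lemma IsGeometric.eq_zero {v : Poly} (hv : IsGeometric v)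
    (h0 : ∀ σ : ℝ → ℝ, ContDiff ℝ ∞ σ → Upsilon 0 σ v = 0) : v = 0 := by
  classical
  -- an arbitrary point is realised, on the variables of `v`, by the jets of some `Γ` and `σ` at `0`
  refine MvPolynomial.funext fun x => ?_
  let idx : Var → ℕ := fun w => match w with | .noise k => k | .quad k => k
  obtain ⟨σ, hσ, -, hσx⟩ := exists_jet (fun k => x (.noise k)) (v.vars.sup idx + 1)
  obtain ⟨Γ, hΓ, hΓc, hΓx⟩ := exists_jet (fun k => x (.quad k) / 2) (v.vars.sup idx + 1)
  obtain ⟨φ, hφ, hφΓ⟩ := exists_actConn_eq_zero hΓ hΓc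
  have h := congrFun (hv Γ σ hΓ hσ φ hφ) (φ 0)
  rw [hφΓ, h0 _ (contDiff_actVec φ hσ)] at h
  simp only [actVec, Diffeomorph.symm_apply_apply, Pi.zero_apply, mul_eq_zero,
    φ.deriv_ne_zero 0, false_or] at h
  rw [map_zero, ← h]
  refine eval₂Hom_congr' rfl (fun w hw _ => ?_) rfl
  have hle : idx w < v.vars.sup idx + 1 := Nat.lt_succ_of_le (Finset.le_sup hw)
  cases w with
  | noise k => exact (hσx k hle).symm
  | quad k => simp only [varValue, hΓx k hle]; ring

/-! ### Monomials as iterated Novikov products -/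

section Novikov

variable {K R : Type*} [CommRing K] [CommRing R] [Algebra K R] (d : Derivation K R R)
  {A : Submodule K R}

/-- If `A` is closed under the Novikov product `a * d b`, then the derivations `a * d` with `a ∈ A`
preserve every power of `A`. -/
lemma mul_derivation_mem_pow (hA : ∀ a ∈ A, ∀ b ∈ A, a * d b ∈ A) {a : R} (ha : a ∈ A) (k : ℕ) :
    ∀ p ∈ A ^ k, a * d p ∈ A ^ k := by
  induction k with
  | zero =>
    intro p hp
    rw [pow_zero] at hp
    obtain ⟨c, rfl⟩ := Submodule.mem_one.1 hp
    simp
  | succ k ih =>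
    intro p hp
    rw [pow_succ] at hp ⊢
    refine Submodule.mul_induction_on hp (fun x hx y hy => ?_) fun x y hx hy => ?_
    · rw [Derivation.leibniz, smul_eq_mul, smul_eq_mul,
        show a * (x * d y + y * d x) = x * (a * d y) + (a * d x) * y by ring]
      exact add_mem (Submodule.mul_mem_mul hx (hA a ha y hy))
        (Submodule.mul_mem_mul (ih x hx) hy)
    · rw [map_add, mul_add]
      exact add_mem hx hy

/-- A submodule closed under the Novikov product `a * d b` is closed under all the operations
`(a₁, …, aₖ, b) ↦ a₁ ⋯ aₖ * dᵏ b`. -/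
lemma mul_iterate_derivation_mem (hA : ∀ a ∈ A, ∀ b ∈ A, a * d b ∈ A) {b : R} (hb : b ∈ A)
    (k : ℕ) : ∀ p ∈ A ^ k, p * d^[k] b ∈ A := by
  induction k with
  | zero =>
    intro p hp
    rw [pow_zero] at hp
    obtain ⟨c, rfl⟩ := Submodule.mem_one.1 hp
    simpa [← Algebra.smul_def] using A.smul_mem c hb
  | succ k ih =>
    intro p hp
    rw [pow_succ'] at hp
    refine Submodule.mul_induction_on hp (fun a ha x hx => ?_) fun x y hx hy => ?_
    · have h1 := hA a ha _ (ih x hx)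
      have h2 := ih _ (mul_derivation_mem_pow d hA ha k x hx)
      rw [Derivation.leibniz, smul_eq_mul, smul_eq_mul] at h1
      rw [Function.iterate_succ_apply']
      convert! sub_mem h1 h2 using 1
      ring
    · rw [add_mul]
      exact add_mem hx hy

end Novikov

/-- The weights whose total is the fertility. -/
def Var.fertility (v : Var) : ℤ := 1 - v.length

lemma fertility_eq_weight (β : MultiIndex) : fertility β = Finsupp.weight Var.fertility β := by
  simp [GKPZ.fertility, Finsupp.weight_apply, Var.fertility, mul_comm]

lemma noiseFactor_eq_weight (β : MultiIndex) :
    noiseFactor β = Finsupp.weight Var.noiseCount β := by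
  simp [noiseFactor, Finsupp.weight_apply]

lemma iterate_D_X_noise (k : ℕ) : D^[k] (X (.noise 0)) = X (.noise k) := by
  induction k with
  | zero => rfl
  | succ k ih => rw [Function.iterate_succ_apply', ih, D_X]; rfl

lemma exists_eq_single_add {β : MultiIndex} {v : Var} (hv : v ∈ β.support) :
    ∃ γ : MultiIndex, β = Finsupp.single v 1 + γ := by
  have : Finsupp.single v 1 ≤ β := by
    classical
    rw [Finsupp.single_le_iff]
    exact Nat.one_le_iff_ne_zero.2 (Finsupp.mem_support_iff.1 hv)
  exact ⟨β - Finsupp.single v 1, (add_tsub_cancel_of_le this).symm⟩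

/-- A monomial in the noise variables of fertility `k ≥ 1` is a combination of products of `k`
elements of any space that contains `z_(Ξ,0)` and is stable under the Novikov product. -/
lemma monomial_mem_pow {A : Submodule ℝ Poly} (hA : ∀ a ∈ A, ∀ b ∈ A, a * D b ∈ A)
    (h0 : X (.noise 0) ∈ A) (n : ℕ) : ∀ β : MultiIndex, β.degree = n →
      (∀ k, β (.quad k) = 0) → ∀ k : ℕ, 1 ≤ k → fertility β = k → monomial β (1 : ℝ) ∈ A ^ k := by
  induction n using Nat.strong_induction_on with
  | _ n ih =>
  intro β hn hq k hk hf
  rw [fertility_eq_weight] at hf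
  -- `z_(Ξ,0)` is the only variable of positive fertility
  have hz : Var.noise 0 ∈ β.support := by
    by_contra hz
    have : Finsupp.weight Var.fertility β ≤ 0 := by
      rw [Finsupp.weight_apply]
      refine Finset.sum_nonpos fun v hv => ?_
      have : v.fertility ≤ 0 := by
        rcases v with (_ | j) | j
        · exact absurd hv hz
        · simp [Var.fertility, Var.length]
        · simp [Var.fertility, Var.length]; omega
      exact nsmul_nonpos this _
    omega
  obtain ⟨γ, rfl⟩ := exists_eq_single_add hz
  have hγq : ∀ k, γ (.quad k) = 0 := fun k => by simpa using hq k
  have hγf : Finsupp.weight Var.fertility γ = k - 1 := by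
    simp [Finsupp.weight_single, Var.fertility, Var.length] at hf
    linarith
  have hγn : γ.degree + 1 = n := by
    rw [← hn]; simp [add_comm]
  have hmul : ∀ (v : Var) (δ : MultiIndex),
      monomial (Finsupp.single v 1 + δ) (1 : ℝ) = X v * monomial δ 1 := fun v δ => by
    rw [X, monomial_mul, one_mul]
  obtain rfl | hk1 := hk.eq_or_lt
  · rw [pow_one]
    by_cases hγ0 : γ = 0
    · subst hγ0
      rw [add_zero]
      exact h0
    · obtain ⟨v, hv, hvf⟩ : ∃ v ∈ γ.support, v.fertility ≤ 0 := by
        by_contra! h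
        have : 0 < Finsupp.weight Var.fertility γ := by
          rw [Finsupp.weight_apply]
          refine Finset.sum_pos (fun v hv => ?_) (Finsupp.support_nonempty_iff.2 hγ0)
          exact nsmul_pos (h v hv) (Finsupp.mem_support_iff.1 hv)
        simp at hγf
        omega
      obtain ⟨j, rfl⟩ : ∃ j, v = .noise j := by
        cases v with
        | noise j => exact ⟨j, rfl⟩
        | quad j => exact absurd (hγq j) (Finsupp.mem_support_iff.1 hv)
      obtain ⟨δ, rfl⟩ := exists_eq_single_add hv
      have hj : 1 ≤ j := by
        simp only [Var.fertility, Var.length] at hvf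
        omega
      rw [add_left_comm, hmul, mul_comm, ← iterate_D_X_noise]
      refine mul_iterate_derivation_mem D hA h0 j _ (ih (n - 1) (by omega) _ ?_ ?_ j hj ?_)
      · rw [← hγn]; simp [add_comm]
      · intro k; simpa using hγq k
      · rw [fertility_eq_weight]
        simp [Finsupp.weight_single, Var.fertility, Var.length] at hγf ⊢
        linarith
  · obtain ⟨k, rfl⟩ := Nat.exists_eq_add_of_lt hk1
    rw [hmul, pow_succ']
    refine Submodule.mul_mem_mul h0 (ih γ.degree (by omega) γ rfl hγq _ (by omega) ?_)
    rw [fertility_eq_weight, hγf]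
    push_cast; ring

/-! ### Gradings by fertility and by number of noises -/

lemma isWeightedHomogeneous_D {M : Type*} [AddCommMonoid M] {w : Var → M} {c m : M}
    (hw : ∀ v : Var, w v.succ = w v + c) {p : Poly} (hp : IsWeightedHomogeneous w p m) :
    IsWeightedHomogeneous w (D p) (m + c) := by
  induction hp using IsWeightedHomogeneous.induction_on with
  | zero => simpa using isWeightedHomogeneous_zero ℝ w (m + c)
  | add p q _ _ hp hq => simpa using hp.add hq
  | monomial d r hr =>
    rw [D, mkDerivation_monomial, Finsupp.sum, smul_eq_C_mul]
    refine IsWeightedHomogeneous.C_mul (IsWeightedHomogeneous.sum _ _ _ fun v hv => ?_) r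
    rw [smul_eq_mul]
    have h := (isWeightedHomogeneous_monomial w (d - Finsupp.single v 1) (d v : ℝ) rfl).mul
      (isWeightedHomogeneous_X ℝ w v.succ)
    rwa [hw, ← add_assoc, Finsupp.weight_sub_single_add (Finsupp.mem_support_iff.1 hv), hr] at h

lemma isWeightedHomogeneous_covDeriv {M : Type*} [AddCommMonoid M] {w : Var → M} {c m n : M}
    (hw : ∀ v : Var, w v.succ = w v + c) (hc : w (.quad 0) = c) {p q : Poly}
    (hp : IsWeightedHomogeneous w p m) (hq : IsWeightedHomogeneous w q n) :
    IsWeightedHomogeneous w (covDeriv p q) (m + n + c) := by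
  have h1 := hp.mul (isWeightedHomogeneous_D hw hq)
  have h2 := ((isWeightedHomogeneous_X ℝ w (.quad 0)).mul hp).mul hq
  rw [← add_assoc] at h1
  rw [hc, show c + m + n = m + n + c by abel] at h2
  rw [covDeriv, smul_eq_C_mul]
  exact h1.add (h2.C_mul _)

lemma IsIterated.isWeightedHomogeneous_noiseCount {N : ℕ} {v : Poly} (h : IsIterated N v) :
    IsWeightedHomogeneous Var.noiseCount v N := by
  induction h with
  | base => exact isWeightedHomogeneous_X ℝ _ _
  | step _ _ h₁ h₂ =>
    exact isWeightedHomogeneous_covDeriv (c := 0) (fun v => by cases v <;> rfl) rfl h₁ h₂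

lemma IsIterated.isWeightedHomogeneous_fertility {N : ℕ} {v : Poly} (h : IsIterated N v) :
    IsWeightedHomogeneous Var.fertility v 1 := by
  induction h with
  | base => exact isWeightedHomogeneous_X ℝ _ _
  | step _ _ h₁ h₂ =>
    refine isWeightedHomogeneous_covDeriv (c := -1) (fun v => ?_) rfl h₁ h₂
    cases v <;> simp [Var.fertility, Var.length, Var.succ] <;> ring

lemma monomialSpan_eq_restrictSupport (S : Set MultiIndex) :
    monomialSpan S = restrictSupport ℝ S := (restrictSupport_eq_span ..).symm

lemma mem_monomialSpan {S : Set MultiIndex} {p : Poly} :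
    p ∈ monomialSpan S ↔ ∀ β, coeff β p ≠ 0 → β ∈ S := by
  rw [monomialSpan_eq_restrictSupport, mem_restrictSupport_iff]
  simp [Set.subset_def]

lemma monomialSpan_mono {S T : Set MultiIndex} (h : S ⊆ T) : monomialSpan S ≤ monomialSpan T :=
  Submodule.span_mono (Set.image_mono h)

lemma span_B_le_VGeoN {N : ℕ} (hN : 2 ≤ N) : Submodule.span ℝ (B N) ≤ VGeoN N := by
  refine Submodule.span_le.2 fun v (hv : IsIterated N v) => ?_
  have h : v ∈ monomialSpan (reducedN N) := mem_monomialSpan.2 fun β hβ => by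
    have h1 : noiseFactor β = N := by
      rw [noiseFactor_eq_weight]; exact hv.isWeightedHomogeneous_noiseCount hβ
    have h2 : fertility β = 1 := by
      rw [fertility_eq_weight]; exact hv.isWeightedHomogeneous_fertility hβ
    exact ⟨⟨h2, h1 ▸ hN⟩, h1⟩
  exact ⟨⟨monomialSpan_mono (fun β hβ => hβ.1) h, hv.isGeometric⟩, h⟩

/-! ### Restriction to the noise variables -/

/-- The projection that sets the variables `quad k` to zero, that is, the restriction to the trivial
connection. -/
noncomputable def noiseProj : Poly →ₐ[ℝ] Poly :=
  aeval fun v => match v with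
    | .noise k => X (.noise k)
    | .quad _ => 0

lemma noiseProj_X_noise (k : ℕ) : noiseProj (X (.noise k)) = X (.noise k) := by
  simp [noiseProj]

lemma noiseProj_X_quad (k : ℕ) : noiseProj (X (.quad k)) = 0 := by
  simp [noiseProj]

lemma noiseProj_D (p : Poly) : noiseProj (D p) = D (noiseProj p) := by
  induction p using MvPolynomial.induction_on with
  | C a => simp [show ∀ a : ℝ, D (C a) = 0 from derivation_C _, noiseProj]
  | add p q hp hq => simp [hp, hq]
  | mul_X p v hp =>
    cases v <;> simp [Derivation.leibniz, D_X, Var.succ, noiseProj_X_noise, noiseProj_X_quad, hp]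

lemma noiseProj_covDeriv (p q : Poly) :
    noiseProj (covDeriv p q) = noiseProj p * D (noiseProj q) := by
  simp [covDeriv, noiseProj_D, noiseProj_X_quad]

lemma Upsilon_zero_noiseProj (σ : ℝ → ℝ) (v : Poly) (u : ℝ) :
    Upsilon 0 σ (noiseProj v) u = Upsilon 0 σ v u := by
  induction v using MvPolynomial.induction_on with
  | C a => simp [noiseProj, Upsilon]
  | add p q hp hq =>
    simp only [Upsilon, map_add] at hp hq ⊢
    rw [hp, hq]
  | mul_X p v hp =>
    simp only [Upsilon, map_mul, eval_X] at hp ⊢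
    rw [hp]
    cases v with
    | noise k => rw [noiseProj_X_noise, eval_X]
    | quad k =>
      rw [noiseProj_X_quad, map_zero, varValue, show (0 : ℝ → ℝ) = fun _ => 0 from rfl,
        iteratedDeriv_const]
      simp

lemma IsGeometric.eq_zero_of_noiseProj_eq_zero {v : Poly} (hv : IsGeometric v)
    (h : noiseProj v = 0) : v = 0 :=
  hv.eq_zero fun σ _ => funext fun u => by
    rw [← Upsilon_zero_noiseProj, h]; simp [Upsilon]

lemma noiseProj_monomial (β : MultiIndex) (r : ℝ) :
    noiseProj (monomial β r) = monomial β r ∧ (∀ k, β (.quad k) = 0) ∨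
      noiseProj (monomial β r) = 0 := by
  rw [noiseProj, aeval_monomial]
  by_cases h : ∀ k, β (.quad k) = 0
  · refine Or.inl ⟨?_, h⟩
    rw [monomial_eq]
    refine congrArg _ (Finset.prod_congr rfl fun v hv => ?_)
    cases v with
    | noise k => rfl
    | quad k => exact absurd (h k) (Finsupp.mem_support_iff.1 hv)
  · push Not at h
    obtain ⟨k, hk⟩ := h
    refine Or.inr ?_
    rw [Finsupp.prod, Finset.prod_eq_zero (Finsupp.mem_support_iff.2 hk) (by simp [hk]), mul_zero]

lemma isWeightedHomogeneous_noiseProj {M : Type*} [AddCommMonoid M] {w : Var → M} {m : M}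
    {p : Poly} (hp : IsWeightedHomogeneous w p m) : IsWeightedHomogeneous w (noiseProj p) m := by
  induction hp using IsWeightedHomogeneous.induction_on with
  | zero => simpa using isWeightedHomogeneous_zero ℝ w m
  | add p q _ _ hp hq => simpa using hp.add hq
  | monomial d r hr =>
    obtain ⟨h, -⟩ | h := noiseProj_monomial d r
    · rw [h]; exact isWeightedHomogeneous_monomial w d r hr
    · rw [h]; exact isWeightedHomogeneous_zero ℝ w m

lemma noiseProj_mem {N : ℕ} {v : Poly} (hv : v ∈ monomialSpan (reducedN N)) :
    noiseProj v ∈ monomialSpan (noiseOnlyN N) := by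
  suffices h : monomialSpan (reducedN N) ≤
      (monomialSpan (noiseOnlyN N)).comap noiseProj.toLinearMap from h hv
  refine Submodule.span_le.2 ?_
  rintro _ ⟨β, hβ, rfl⟩
  change noiseProj (monomial β 1) ∈ monomialSpan (noiseOnlyN N)
  obtain ⟨h, hq⟩ | h := noiseProj_monomial β 1
  · rw [h]
    exact Submodule.subset_span ⟨β, ⟨hβ, hq⟩, rfl⟩
  · rw [h]
    exact zero_mem _

/-! ### The iterated covariant derivatives span -/

/-- The images of the iterated covariant derivatives are the iterated Novikov products of
`z_(Ξ,0)`, which span the free Novikov algebra. -/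
lemma monomial_mem_map_span_B {β : MultiIndex} (hq : ∀ k, β (.quad k) = 0)
    (hf : fertility β = 1) :
    monomial β (1 : ℝ) ∈ (Submodule.span ℝ (⋃ i, B i)).map noiseProj.toLinearMap := by
  rw [← pow_one (Submodule.map _ _)]
  refine monomial_mem_pow ?_ ?_ _ β rfl hq 1 le_rfl (by exact_mod_cast hf)
  · rintro _ ⟨a, ha, rfl⟩ _ ⟨b, hb, rfl⟩
    refine Submodule.span_induction₂ (p := fun a b _ _ => noiseProj.toLinearMap a *
      D (noiseProj.toLinearMap b) ∈ (Submodule.span ℝ (⋃ i, B i)).map noiseProj.toLinearMap)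
      ?_ ?_ ?_ ?_ ?_ ?_ ?_ ha hb
    · intro a b ha hb
      obtain ⟨i, hi⟩ := Set.mem_iUnion.1 ha
      obtain ⟨j, hj⟩ := Set.mem_iUnion.1 hb
      exact ⟨covDeriv a b, Submodule.subset_span (Set.mem_iUnion.2 ⟨i + j, IsIterated.step hi hj⟩),
        noiseProj_covDeriv a b⟩
    · simp
    · simp
    · intro a b c _ _ _ h1 h2
      rw [map_add, add_mul]
      exact add_mem h1 h2
    · intro a b c _ _ _ h1 h2
      rw [map_add, map_add, mul_add]
      exact add_mem h1 h2
    · intro r a b _ _ h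
      rw [map_smul, smul_mul_assoc]
      exact Submodule.smul_mem _ r h
    · intro r a b _ _ h
      rw [map_smul, Derivation.map_smul, mul_smul_comm]
      exact Submodule.smul_mem _ r h
  · exact ⟨X (.noise 0), Submodule.subset_span (Set.mem_iUnion.2 ⟨1, .base⟩), noiseProj_X_noise 0⟩

lemma exists_mem_span_B_noiseProj_eq_component (N : ℕ) {x : Poly}
    (hx : x ∈ Submodule.span ℝ (⋃ i, B i)) : ∃ y ∈ Submodule.span ℝ (B N),
      noiseProj y = weightedHomogeneousComponent Var.noiseCount N (noiseProj x) := by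
  induction hx using Submodule.span_induction with
  | mem x hx =>
    obtain ⟨i, hi : IsIterated i x⟩ := Set.mem_iUnion.1 hx
    have h := isWeightedHomogeneous_noiseProj hi.isWeightedHomogeneous_noiseCount
    by_cases hN : N = i
    · subst hN
      exact ⟨x, Submodule.subset_span hi, h.weightedHomogeneousComponent_same.symm⟩
    · exact ⟨0, zero_mem _, by rw [h.weightedHomogeneousComponent_ne N hN, map_zero]⟩
  | zero => exact ⟨0, zero_mem _, by simp⟩
  | add x y _ _ hx hy =>
    obtain ⟨a, ha, hax⟩ := hx
    obtain ⟨b, hb, hby⟩ := hy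
    exact ⟨a + b, add_mem ha hb, by simp only [map_add, hax, hby]⟩
  | smul r x _ hx =>
    obtain ⟨a, ha, hax⟩ := hx
    exact ⟨r • a, Submodule.smul_mem _ r ha, by simp only [map_smul, hax]⟩

lemma monomialSpan_noiseOnlyN_le (N : ℕ) :
    monomialSpan (noiseOnlyN N) ≤ (Submodule.span ℝ (B N)).map noiseProj.toLinearMap := by
  refine Submodule.span_le.2 ?_
  rintro _ ⟨β, ⟨⟨⟨hf, -⟩, hN⟩, hq⟩, rfl⟩
  obtain ⟨x, hx, hxβ⟩ := monomial_mem_map_span_B hq hf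
  obtain ⟨y, hy, hyx⟩ := exists_mem_span_B_noiseProj_eq_component N hx
  refine ⟨y, hy, hyx.trans ?_⟩
  rw [show noiseProj x = monomial β 1 from hxβ]
  refine (isWeightedHomogeneous_monomial _ _ _ ?_).weightedHomogeneousComponent_same
  rw [← noiseFactor_eq_weight, hN]

lemma span_B_eq_VGeoN {N : ℕ} (hN : 2 ≤ N) : Submodule.span ℝ (B N) = VGeoN N := by
  refine le_antisymm (span_B_le_VGeoN hN) fun v hv => ?_
  obtain ⟨y, hy, hyv⟩ := monomialSpan_noiseOnlyN_le N (noiseProj_mem hv.2)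
  have hg : IsGeometric (v + (-1 : ℝ) • y) :=
    IsGeometric.add hv.1.2 (IsGeometric.smul (span_B_le_VGeoN hN hy).1.2 _)
  have h0 : v + (-1 : ℝ) • y = 0 := hg.eq_zero_of_noiseProj_eq_zero <| by
    rw [map_add, map_smul, ← show noiseProj y = noiseProj v from hyv]
    simp
  rw [neg_one_smul, ← sub_eq_add_neg, sub_eq_zero] at h0
  exact h0 ▸ hy

/-! ### Dimensions -/

lemma noiseOnlyN_finite (N : ℕ) : (noiseOnlyN N).Finite := by
  classical
  refine (Set.finite_Iic (∑ k ∈ Finset.range (N + 1), Finsupp.single (Var.noise k) N)).subset ?_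
  rintro β ⟨⟨⟨hf, -⟩, hN⟩, hq⟩ v
  rw [fertility_eq_weight] at hf
  rw [noiseFactor_eq_weight] at hN
  cases v with
  | quad k => rw [hq k]; exact Nat.zero_le _
  | noise k =>
    by_cases h0 : β (.noise k) = 0
    · rw [h0]; exact Nat.zero_le _
    obtain ⟨γ, hγ⟩ := exists_eq_single_add (Finsupp.mem_support_iff.2 h0)
    have hle : β (.noise k) ≤ N := by
      rw [← hN, Finsupp.weight_apply]
      refine le_trans ?_ (Finset.single_le_sum (f := fun v => β v • v.noiseCount)
        (fun _ _ => Nat.zero_le _) (Finsupp.mem_support_iff.2 h0))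
      simp [Var.noiseCount]
    -- the remaining monomial has fertility at most its number of noises
    have hk : k < N + 1 := by
      have h1 : Finsupp.weight Var.fertility γ ≤ (Finsupp.weight Var.noiseCount γ : ℕ) := by
        rw [Finsupp.weight_apply, Finsupp.weight_apply, Finsupp.sum, Finsupp.sum, Nat.cast_sum]
        refine Finset.sum_le_sum fun v _ => ?_
        rw [nsmul_eq_mul, smul_eq_mul, Nat.cast_mul]
        refine mul_le_mul_of_nonneg_left ?_ (Nat.cast_nonneg _)
        cases v <;> simp [Var.fertility, Var.length, Var.noiseCount]
        omega
      rw [hγ] at hf hN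
      simp [Finsupp.weight_single, Var.fertility, Var.length, Var.noiseCount] at hf hN
      change _ ≤ ((Finsupp.weight Var.noiseCount γ : ℕ) : ℤ) at h1
      omega
    have hs : (∑ k ∈ Finset.range (N + 1), Finsupp.single (Var.noise k) N) (.noise k) = N := by
      rw [Finsupp.finsetSum_apply, Finset.sum_eq_single k] <;> simp +contextual
      omega
    rwa [hs]

lemma finite_monomialSpan {S : Set MultiIndex} (hS : S.Finite) :
    Module.Finite ℝ (monomialSpan S) := by
  have := hS.to_subtype
  rw [monomialSpan_eq_restrictSupport]
  exact Module.Finite.of_basis (basisRestrictSupport ℝ S)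

lemma finrank_monomialSpan (S : Set MultiIndex) :
    Module.finrank ℝ (monomialSpan S) = S.ncard := by
  rw [monomialSpan_eq_restrictSupport,
    Module.finrank_eq_nat_card_basis (basisRestrictSupport ℝ S), Nat.card_coe_set_eq]

/-- The restriction of `noiseProj` to the geometric elements with `N` noises is a bijection onto
the degree `N` part of the free Novikov algebra. -/
lemma nonempty_VGeoN_equiv {N : ℕ} (hN : 2 ≤ N) :
    Nonempty (VGeoN N ≃ₗ[ℝ] monomialSpan (noiseOnlyN N)) := by
  let f : VGeoN N →ₗ[ℝ] monomialSpan (noiseOnlyN N) :=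
    (noiseProj.toLinearMap.domRestrict (VGeoN N)).codRestrict _ fun v => noiseProj_mem v.2.2
  refine ⟨LinearEquiv.ofBijective f ⟨?_, fun w => ?_⟩⟩
  · refine (injective_iff_map_eq_zero f).2 fun v hv => Subtype.ext ?_
    exact IsGeometric.eq_zero_of_noiseProj_eq_zero v.2.1.2 (congrArg Subtype.val hv)
  · obtain ⟨y, hy, hyw⟩ := monomialSpan_noiseOnlyN_le N w.2
    exact ⟨⟨y, span_B_le_VGeoN hN hy⟩, Subtype.ext hyw⟩

lemma finite_VGeoN {N : ℕ} (hN : 2 ≤ N) : Module.Finite ℝ (VGeoN N) := by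
  obtain ⟨e⟩ := nonempty_VGeoN_equiv hN
  have := finite_monomialSpan (noiseOnlyN_finite N)
  exact Module.Finite.equiv e.symm

lemma finrank_VGeoN {N : ℕ} (hN : 2 ≤ N) :
    Module.finrank ℝ (VGeoN N) = (noiseOnlyN N).ncard := by
  obtain ⟨e⟩ := nonempty_VGeoN_equiv hN
  rw [e.finrank_eq, finrank_monomialSpan]

lemma disjoint_monomialSpan {S T : Set MultiIndex} (h : Disjoint S T) :
    Disjoint (monomialSpan S) (monomialSpan T) := by
  refine Submodule.disjoint_def.2 fun p hS hT => MvPolynomial.ext _ _ fun β => ?_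
  by_contra hβ
  exact Set.disjoint_left.1 h (mem_monomialSpan.1 hS β hβ) (mem_monomialSpan.1 hT β hβ)

lemma supIndep_VGeoN (s : Finset ℕ) : s.SupIndep VGeoN := by
  intro t _ i _ hit
  have h : t.sup VGeoN ≤ monomialSpan {β | noiseFactor β ∈ t} :=
    Finset.sup_le fun j hj => inf_le_right.trans
      (monomialSpan_mono fun β hβ => by simpa [hβ.2] using hj)
  refine (disjoint_monomialSpan ?_).mono inf_le_right h
  exact Set.disjoint_left.2 fun β hβ hβt => hit (hβ.2 ▸ hβt)

/-- The dimension of a finite independent sum of finite-dimensional subspaces. -/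
lemma finite_and_finrank_sup {K V ι : Type*} [DivisionRing K] [AddCommGroup V] [Module K V]
    {W : ι → Submodule K V} (s : Finset ι) (hfin : ∀ i ∈ s, Module.Finite K (W i))
    (hs : s.SupIndep W) : Module.Finite K (s.sup W : Submodule K V) ∧
      Module.finrank K (s.sup W : Submodule K V) = ∑ i ∈ s, Module.finrank K (W i) := by
  classical
  induction s using Finset.induction_on with
  | empty =>
    rw [Finset.sup_empty]
    exact ⟨inferInstance, by simp⟩
  | insert i s hi ih =>
    obtain ⟨h1, h2⟩ := ih (fun j hj => hfin j (Finset.mem_insert_of_mem hj))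
      (hs.subset (Finset.subset_insert i s))
    have h3 := hfin i (Finset.mem_insert_self i s)
    have hd : Disjoint (W i) (s.sup W) :=
      hs (Finset.subset_insert i s) (Finset.mem_insert_self i s) hi
    rw [Finset.sup_insert, Finset.sum_insert hi, ← h2]
    refine ⟨inferInstance, ?_⟩
    have := Submodule.finrank_sup_add_finrank_inf_eq (W i) (s.sup W)
    rwa [hd.eq_bot, finrank_bot, add_zero] at this

lemma sum_VGeoN (s : Finset ℕ) (hs : ∀ i ∈ s, 2 ≤ i) :
    Submodule.span ℝ (⋃ i ∈ s, B i) = s.sup VGeoN ∧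
      Module.Finite ℝ (s.sup VGeoN : Submodule ℝ Poly) ∧
      Module.finrank ℝ (s.sup VGeoN : Submodule ℝ Poly) = ∑ i ∈ s, (noiseOnlyN i).ncard := by
  obtain ⟨h1, h2⟩ := finite_and_finrank_sup s (fun i hi => finite_VGeoN (hs i hi))
    (supIndep_VGeoN s)
  refine ⟨?_, h1, h2.trans (Finset.sum_congr rfl fun i hi => finrank_VGeoN (hs i hi))⟩
  simp only [Submodule.span_iUnion, Finset.sup_eq_iSup]
  exact iSup_congr fun i => iSup_congr fun hi => span_B_eq_VGeoN (hs i hi)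

end GKPZ

theorem theorem3p10 :
    (∀ N : ℕ, 2 ≤ N →
      Submodule.span ℝ (GKPZ.B N) = GKPZ.VGeoN N ∧
      (GKPZ.noiseOnlyN N).Finite ∧
      Module.Finite ℝ (GKPZ.VGeoN N) ∧
      Module.finrank ℝ (GKPZ.VGeoN N) = (GKPZ.noiseOnlyN N).ncard) ∧
    (∀ n : ℕ,
      Submodule.span ℝ (GKPZ.BXi n) = GKPZ.VGeoXi n ∧
      Module.Finite ℝ (GKPZ.VGeoXi n) ∧
      Module.finrank ℝ (GKPZ.VGeoXi n) =
        ∑ i ∈ Finset.Icc 2 n, (GKPZ.noiseOnlyN i).ncard) ∧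
    (∀ n : ℕ,
      Submodule.span ℝ (GKPZ.BXiEven n) = GKPZ.VGeoXiEven n ∧
      Module.Finite ℝ (GKPZ.VGeoXiEven n) ∧
      Module.finrank ℝ (GKPZ.VGeoXiEven n) =
        ∑ i ∈ Finset.Icc 1 (n / 2), (GKPZ.noiseOnlyN (2 * i)).ncard) := by
  refine ⟨fun N hN => ⟨GKPZ.span_B_eq_VGeoN hN, GKPZ.noiseOnlyN_finite N, GKPZ.finite_VGeoN hN,
    GKPZ.finrank_VGeoN hN⟩, fun n => ?_, fun n => ?_⟩
  · have h := GKPZ.sum_VGeoN (Finset.Icc 2 n) fun i hi => (Finset.mem_Icc.1 hi).1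
    rwa [Finset.sup_eq_iSup] at h
  · have h := GKPZ.sum_VGeoN
      ((Finset.Icc 1 (n / 2)).map ⟨(2 * ·), mul_right_injective₀ two_ne_zero⟩) fun i hi => by
        obtain ⟨j, hj, rfl⟩ := Finset.mem_map.1 hi
        have := (Finset.mem_Icc.1 hj).1
        simp only [Function.Embedding.coeFn_mk]
        omega
    rw [Finset.sup_map, Finset.sum_map, Finset.sup_eq_iSup] at h
    rwa [show (⋃ i ∈ (Finset.Icc 1 (n / 2)).map _, GKPZ.B i) = GKPZ.BXiEven n by
      simp [GKPZ.BXiEven]] at h
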